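/- Let $G$ be a finite graph with a set $R\subseteq V(G)$ of terminals, and let $r\in\mathbb N$. A tree is called $r$-decorated if at least $r$ of its leaves (vertices of degree one) are terminals. A tree-decomposition $(T,(B_t)_{t\in V(T)})$ of $G$ consists of a tree $T$ and bags $B_t\subseteq V(G)$ such that every vertex and every edge of $G$ is contained in some bag, and for each $v\in V(G)$ the set $\{t\in V(T): v\in B_t\}$ induces a connected subgraph of $T$; its adhesion-size is $\max\{|B_t\cap B_{t'}| : tt'\in E(T)\}$. There is a function $f:\mathbb N\to\mathbb N$ with $f(r)\in O(r^2)$ such that for all $r$, $G$ and $R$ as above the following holds. If $G$ has no $r$-decorated tree as a (not necessarily induced) subgraph, then $G$ has a tree-decomposition $(T,(B_t)_{t\in V(T)})$ whose adhesion-size is at most $f(r)$ and whose tree $T$ has maximum degree at most $f(r)$, such that for every $t\in V(T)$ at least one of the following holds: 1. $|B_t|\le f(r)$; 2. $t$ is a leaf of $T$, with neighbor $t'$, and $B_t\cap R\subseteq B_{t'}$. Moreover, such a decomposition can be computed in polynomial time: there is an algorithm (on a random access machine with addition and subtraction as its arithmetic operations) that, given $G$, $R$ and $r$ such that $G$ has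 no $r$-decorated tree as a subgraph, outputs a tree-decomposition with these properties (for the same function $f$) after a number of steps bounded by a polynomial in $|V(G)|$. -/

import Mathlib

/-! ## Decorated trees and tree-decompositions -/

namespace Decorated

/-- A leaf is a vertex of degree one. -/
def IsLeaf {W : Type*} (T : SimpleGraph W) (t : W) : Prop :=
  (T.neighborSet t).ncard = 1

/-- A graph `T` with terminal set `R` is `r`-decorated if it is a tree and at least `r` of its
leaves are terminals. -/
def IsDecorated {W : Type*} (T : SimpleGraph W) (R : Set W) (r : ℕ) : Prop :=
  T.IsTree ∧ r ≤ {v : W | IsLeaf T v ∧ v ∈ R}.ncard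

/-- Some subgraph of `G` (not necessarily induced) is an `r`-decorated tree with respect to the
terminals of `G` that it contains. -/
def HasDecoratedSubtree {V : Type*} (G : SimpleGraph V) (R : Set V) (r : ℕ) : Prop :=
  ∃ H : G.Subgraph, IsDecorated H.coe {v : H.verts | (v : V) ∈ R} r

/-- `(T, B)` is a tree-decomposition of `G`. Bags may be empty, `G` may be disconnected. -/
structure IsTreeDecomposition {V ι : Type*} (G : SimpleGraph V) (T : SimpleGraph ι)
    (B : ι → Set V) : Prop where
  isTree : T.IsTree
  cover : ∀ v : V, ∃ t : ι, v ∈ B t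
  edge : ∀ u v : V, G.Adj u v → ∃ t : ι, u ∈ B t ∧ v ∈ B t
  connected : ∀ v : V, (T.induce {t : ι | v ∈ B t}).Connected

/-- The adhesion-size, i.e. the maximum of `|B t ∩ B t'|` over the edges `tt'`, is at most `k`. -/
def AdhesionSizeLE {V ι : Type*} (T : SimpleGraph ι) (B : ι → Set V) (k : ℕ) : Prop :=
  ∀ t t' : ι, T.Adj t t' → (B t ∩ B t').ncard ≤ k

/-- Every vertex of `T` has degree at most `k`. -/
def DegreeLE {ι : Type*} (T : SimpleGraph ι) (k : ℕ) : Prop :=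
  ∀ t : ι, (T.neighborSet t).ncard ≤ k

/-- `(T, B)` is a tree-decomposition of `G` whose adhesion-size and maximum degree are at most `k`,
and each bag has at most `k` vertices or belongs to a leaf `t` of `T` such that all
terminals in the bag lie in the bag of the neighbor `t'` of `t`. -/
structure IsRefinedDecomposition {V ι : Type*} (G : SimpleGraph V) (R : Set V) (k : ℕ)
    (T : SimpleGraph ι) (B : ι → Set V) : Prop where
  isTreeDecomposition : IsTreeDecomposition G T B
  adhesion : AdhesionSizeLE T B k
  degree : DegreeLE T k
  bags : ∀ t : ι, (B t).ncard ≤ k ∨ (IsLeaf T t ∧ ∃ t' : ι, T.Adj t t' ∧ B t ∩ R ⊆ B t')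

end Decorated

/-! ## A random access machine

Structured programs over natural-number registers and (two-dimensional) arrays. The only arithmetic
operations are addition and truncated subtraction, so a run of `k` steps touches `O(k)` cells, and
every number it produces has bit length at most that of the largest input number plus `O(k)`:
running times agree up to polynomials with those of Turing machines. -/

namespace RAM

/-- Memory: `reg x` is the register `x`, and `arr a i j` is the entry `(i, j)` of the array `a`. -/
structure State where
  reg : ℕ → ℕ
  arr : ℕ → ℕ → ℕ → ℕ

/-- Expressions. Names of registers and arrays are fixed in the program text; array indices are
computed. -/
inductive Expr where
  | const (c : ℕ)
  | reg (x : ℕ)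
  | get (a : ℕ) (i j : Expr)
  | add (e e' : Expr)
  | sub (e e' : Expr)

namespace Expr

/-- Value of an expression. -/
def eval (s : State) : Expr → ℕ
  | const c => c
  | reg x => s.reg x
  | get a i j => s.arr a (i.eval s) (j.eval s)
  | add e e' => e.eval s + e'.eval s
  | sub e e' => e.eval s - e'.eval s

/-- Number of steps needed to evaluate an expression: one for each constant, memory access and
arithmetic operation. -/
def cost : Expr → ℕ
  | const _ => 1
  | reg _ => 1
  | get _ i j => i.cost + j.cost + 1
  | add e e' => e.cost + e'.cost + 1
  | sub e e' => e.cost + e'.cost + 1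

end Expr

/-- Programs. -/
inductive Prog where
  | skip
  /-- `x := e` -/
  | assign (x : ℕ) (e : Expr)
  /-- `a[i, j] := e` -/
  | store (a : ℕ) (i j e : Expr)
  /-- `p; q` -/
  | seq (p q : Prog)
  /-- if `e ≠ 0` then `p` else `q` -/
  | branch (e : Expr) (p q : Prog)
  /-- while `e ≠ 0` do `p` -/
  | loop (e : Expr) (p : Prog)

/-- The state after `x := c`. -/
def State.setReg (s : State) (x c : ℕ) : State where
  reg := Function.update s.reg x c
  arr := s.arr

/-- The state after `a[i, j] := c`. -/
def State.setArr (s : State) (a i j c : ℕ) : State where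
  reg := s.reg
  arr := Function.update s.arr a
    (Function.update (s.arr a) i (Function.update (s.arr a i) j c))

/-- `Runs p s k s'`: started in the state `s`, the program `p` halts in the state `s'` after
exactly `k` steps. -/
inductive Runs : Prog → State → ℕ → State → Prop where
  | skip (s : State) : Runs Prog.skip s 1 s
  | assign (s : State) (x : ℕ) (e : Expr) :
      Runs (Prog.assign x e) s (e.cost + 1) (s.setReg x (e.eval s))
  | store (s : State) (a : ℕ) (i j e : Expr) :
      Runs (Prog.store a i j e) s (i.cost + j.cost + e.cost + 1)
        (s.setArr a (i.eval s) (j.eval s) (e.eval s))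
  | seq {p q : Prog} {s s' s'' : State} {k l : ℕ} (hp : Runs p s k s') (hq : Runs q s' l s'') :
      Runs (Prog.seq p q) s (k + l) s''
  | branch_ne {e : Expr} {p q : Prog} {s s' : State} {k : ℕ} (he : e.eval s ≠ 0)
      (hp : Runs p s k s') : Runs (Prog.branch e p q) s (e.cost + 1 + k) s'
  | branch_eq {e : Expr} {p q : Prog} {s s' : State} {k : ℕ} (he : e.eval s = 0)
      (hq : Runs q s k s') : Runs (Prog.branch e p q) s (e.cost + 1 + k) s'
  | loop_ne {e : Expr} {p : Prog} {s s' s'' : State} {k l : ℕ} (he : e.eval s ≠ 0)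
      (hp : Runs p s k s') (hl : Runs (Prog.loop e p) s' l s'') :
      Runs (Prog.loop e p) s (e.cost + 1 + k + l) s''
  | loop_eq {e : Expr} {p : Prog} {s : State} (he : e.eval s = 0) :
      Runs (Prog.loop e p) s (e.cost + 1) s

end RAM

namespace Decorated

open Classical in
/-- Input of the algorithm: register `0` holds the number `n` of vertices, register `1` holds `r`,
array `0` is the adjacency matrix of `G`, row `0` of array `1` is the indicator
vector of the terminals; everything else is `0`. -/
noncomputable def inputState {n : ℕ} (G : SimpleGraph (Fin n)) (R : Set (Fin n)) (r : ℕ) :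
    RAM.State where
  reg x := if x = 0 then n else if x = 1 then r else 0
  arr a i j :=
    if a = 0 ∧ ∃ (hi : i < n) (hj : j < n), G.Adj ⟨i, hi⟩ ⟨j, hj⟩ then 1
    else if a = 1 ∧ i = 0 ∧ ∃ hj : j < n, (⟨j, hj⟩ : Fin n) ∈ R then 1
    else 0

/-- Output of the algorithm: register `2` holds the number `m` of vertices of the tree `T`,
array `2` its adjacency matrix, and row `t` of array `3` is the indicator vector of
the bag of `t` (nonzero entries stand for "true"). -/
structure IsOutput {n m : ℕ} (s : RAM.State) (T : SimpleGraph (Fin m))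
    (B : Fin m → Set (Fin n)) : Prop where
  size : s.reg 2 = m
  tree : ∀ t t' : Fin m, T.Adj t t' ↔ s.arr 2 t t' ≠ 0
  bag : ∀ (t : Fin m) (v : Fin n), v ∈ B t ↔ s.arr 3 t v ≠ 0

end Decorated

namespace Decorated

/-! ## Trees with many terminal leaves -/

/-! The linear bound `2 * r + 3` is proved for `f`. The vertices of `G` are visited one at a time
and receive levels. While level `j` is current, an unvisited nonterminal next to a visited vertex
joins level `j`, and so does an unvisited terminal next to a visited vertex of level below `j`. When
neither exists, every edge leaving the visited set runs from level `j` to a terminal, and one such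
terminal opens level `j + 1`. If no edge leaves the visited set, any unvisited terminal opens a new
level and starts a new component.

Within the current component, the visited vertices below level `j` form a connected set `D`, and
(except on a level that starts a component, which has only its first terminal) every terminal of
level `j` has a neighbor in `D`. A spanning tree of `D` with these terminals hung on as leaves is
decorated (`hasDecoratedSubtree_of_connected`), so a level has at most `r + 1` terminals.
`IsLayering.same`, `IsLayering.next` and `IsLayering.root` preserve the invariants.

Edges between different visited levels go up by exactly one and end in a terminal. Hence the
terminals of levels `i` and `i + 1` separate the nonterminals of level `i` from the rest: they form
the spine bags of a caterpillar, and each leaf bag adds the nonterminals of one level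
(`IsLayering.isRefinedDecomposition`). Components without terminals stay on level `0`.

The search never consults `r`. A program performs `n` rounds of it, each scanning all pairs of
vertices, in time polynomial in `n` (`ensures_decomposition`). -/

/-- If `D` is connected and each vertex of `L ⊆ R` outside `D` has a neighbor in `D`, then some
subtree on `D ∪ L` has all vertices of `L` as leaves. -/
theorem hasDecoratedSubtree_of_connected {V : Type*} [Finite V] {G : SimpleGraph V} {R : Set V}
    {r : ℕ} {D L : Set V} (hD : (G.induce D).Connected) (hLR : L ⊆ R) (hDL : Disjoint D L)
    (hadj : ∀ v ∈ L, ∃ u ∈ D, G.Adj u v) (hr : r ≤ L.ncard) : HasDecoratedSubtree G R r := by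
  classical
  choose! φ hφD hφA using hadj
  have hnot : ∀ {v : V}, v ∈ D → v ∉ L := fun hv hv' => Set.disjoint_left.1 hDL hv hv'
  -- `K` keeps the edges inside `D` and, for each vertex of `L`, only the edge to one chosen
  -- neighbor in `D`. Any spanning tree of `K` then has `L` among its leaves.
  let K : SimpleGraph ↥(D ∪ L) :=
    { Adj := fun a b => G.Adj a b ∧ (a.1 ∈ L → b.1 = φ a) ∧ (b.1 ∈ L → a.1 = φ b)
      symm := ⟨fun a b h => ⟨h.1.symm, h.2.2, h.2.1⟩⟩
      loopless := ⟨fun a h => G.loopless.irrefl _ h.1⟩ }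
  obtain ⟨d⟩ := hD.nonempty
  have hK : K.Connected := by
    rw [SimpleGraph.connected_iff_exists_forall_reachable]
    refine ⟨⟨d.1, Or.inl d.2⟩, ?_⟩
    let ψ : G.induce D →g K :=
      { toFun := fun x => ⟨x.1, Or.inl x.2⟩
        map_rel' := fun {a b} h => ⟨h, fun ha => absurd ha (hnot a.2), fun hb => absurd hb (hnot b.2)⟩ }
    have hDr : ∀ x (hx : x ∈ D), K.Reachable ⟨d.1, Or.inl d.2⟩ ⟨x, Or.inl hx⟩ := fun x hx =>
      (hD.preconnected d ⟨x, hx⟩).map ψ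
    rintro ⟨x, hx | hx⟩
    · exact hDr x hx
    · refine (hDr (φ x) (hφD x hx)).trans (SimpleGraph.Adj.reachable ?_)
      exact ⟨hφA x hx, fun h => absurd h (hnot (hφD x hx)), fun _ => rfl⟩
  obtain ⟨T, hTK, hT⟩ := hK.exists_isTree_le
  let H : G.Subgraph :=
    { verts := D ∪ L
      Adj := fun a b => ∃ (ha : a ∈ D ∪ L) (hb : b ∈ D ∪ L), T.Adj ⟨a, ha⟩ ⟨b, hb⟩
      adj_sub := by rintro a b ⟨_, _, h⟩; exact (hTK h).1
      edge_vert := by rintro a b ⟨ha, _, _⟩; exact ha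
      symm := ⟨by rintro a b ⟨ha, hb, h⟩; exact ⟨hb, ha, h.symm⟩⟩ }
  have hcoe : H.coe = T := by
    ext a b
    constructor
    · rintro ⟨_, _, h⟩; exact h
    · exact fun h => ⟨a.2, b.2, h⟩
  refine ⟨H, ?_⟩
  change IsDecorated (W := ↥(D ∪ L)) H.coe _ r
  rw [hcoe]
  refine ⟨hT, hr.trans ?_⟩
  refine Set.ncard_le_ncard_of_injOn
    (fun v => if h : v ∈ D ∪ L then (⟨v, h⟩ : ↥(D ∪ L)) else ⟨d.1, Or.inl d.2⟩) ?_ ?_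
    (Set.toFinite _)
  · intro v hv
    have hv' : v ∈ D ∪ L := Or.inr hv
    simp only [hv', dif_pos]
    refine ⟨?_, hLR hv⟩
    -- A walk to `d`, which is not in `L`, supplies a neighbor of `v`; in `K` it can only be `φ v`.
    obtain ⟨p⟩ := hT.1.preconnected ⟨v, hv'⟩ ⟨d.1, Or.inl d.2⟩
    cases p with
    | nil => exact absurd hv (hnot d.2)
    | @cons _ w _ h _ =>
      refine Set.ncard_eq_one.2 ⟨w, Set.eq_singleton_iff_unique_mem.2 ⟨h, fun x hx => ?_⟩⟩
      exact Subtype.ext (((hTK hx).2.1 hv).trans ((hTK h).2.1 hv).symm)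
  · intro a ha b hb hab
    have ha' : a ∈ D ∪ L := Or.inr ha
    have hb' : b ∈ D ∪ L := Or.inr hb
    simpa only [ha', hb', dif_pos, Subtype.mk.injEq] using hab

/-- Adding a neighbor of a preconnected set. -/
theorem preconnected_induce_insert {V : Type*} {G : SimpleGraph V} {C : Set V} {u v : V}
    (hC : (G.induce C).Preconnected) (hu : u ∈ C) (huv : G.Adj u v) :
    (G.induce (insert v C)).Preconnected := by
  rw [Set.insert_eq, Set.union_comm]
  refine (SimpleGraph.connected_induce_union (G := G) hC ?_ hu (Set.mem_singleton v)
    huv).preconnected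
  rintro ⟨a, rfl⟩ ⟨b, rfl⟩
  exact SimpleGraph.Reachable.refl _

/-! ## Level functions -/

/-- A partial level function: vertices of level `0` are not yet visited, and `j` is the current
level. Levels grow by one from a vertex to an adjacent terminal and are constant on connected sets
of nonterminals; each component starts on a level of its own. -/
structure IsLayering {V : Type*} (G : SimpleGraph V) (R : Set V) (r : ℕ) (lev : V → ℕ) (j : ℕ) :
    Prop where
  le : ∀ v, lev v ≤ j
  count : j ≤ {v | lev v ≠ 0}.ncard
  edge : ∀ u v, G.Adj u v → lev u ≠ 0 → lev u < lev v → v ∈ R ∧ lev v = lev u + 1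
  frontier : ∀ u v, G.Adj u v → lev u ≠ 0 → lev v = 0 → lev u = j ∨ (lev u + 1 = j ∧ v ∈ R)
  small : ∀ i, i ≠ 0 → {v | v ∈ R ∧ lev v = i}.ncard ≤ r + 1
  region : ∃ C : Set V, (∀ v ∈ C, lev v ≠ 0) ∧ (G.induce C).Preconnected ∧
    (G.induce {u | u ∈ C ∧ lev u < j}).Preconnected ∧
    (∀ u v, G.Adj u v → lev u ≠ 0 → lev v = 0 → u ∈ C) ∧
    (((∀ u ∈ C, ¬ lev u < j) ∧ ∃ w, ∀ v ∈ R, lev v ≠ 0 → lev v = j → v = w) ∨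
      ∀ v ∈ R, lev v ≠ 0 → lev v = j → ∃ u ∈ C, lev u < j ∧ G.Adj u v)

/-- A vertex may be added on the current level. -/
def SameLevel {V : Type*} (G : SimpleGraph V) (R : Set V) (lev : V → ℕ) (j : ℕ) (u v : V) : Prop :=
  G.Adj u v ∧ lev u ≠ 0 ∧ lev v = 0 ∧ (v ∉ R ∨ lev u < j)

namespace IsLayering

variable {V : Type*} {G : SimpleGraph V} {R : Set V} {r : ℕ} {lev : V → ℕ} {j : ℕ}

theorem zero : IsLayering G R r (fun _ => 0) 0 where
  le _ := le_rfl
  count := Nat.zero_le _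
  edge _ _ _ h := absurd rfl h
  frontier _ _ _ h := absurd rfl h
  small i hi := by simp [hi.symm]
  region := ⟨∅, by simp, fun a => a.2.elim, fun a => a.2.1.elim, by simp,
    Or.inr (by simp)⟩

variable [Finite V]

theorem ncard_visited_update [DecidableEq V] {v : V} {i : ℕ} (hv : lev v = 0) (hi : i ≠ 0) :
    {w | Function.update lev v i w ≠ 0}.ncard = {w | lev w ≠ 0}.ncard + 1 := by
  rw [← Set.ncard_insert_of_notMem (a := v) (by simpa using hv)]
  congr 1
  ext w
  by_cases h : w = v
  · subst h; simpa using hi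
  · simp [h]

/-- The new vertex gets level `j`, so the part of the region below `j` is unchanged and stays
connected. This is where the absence of a decorated tree enters, to keep the level small. -/
theorem same [DecidableEq V] (hG : ¬ HasDecoratedSubtree G R r) (h : IsLayering G R r lev j)
    {u v : V} (huv : SameLevel G R lev j u v) :
    IsLayering G R r (Function.update lev v j) j := by
  obtain ⟨hadj, hu, hv, hor⟩ := huv
  have hj : j ≠ 0 := fun h0 => hu (Nat.le_zero.1 (h0 ▸ h.le u))
  obtain ⟨C, hC0, hC, hD, hCf, hL⟩ := h.region
  have hvC : v ∉ C := fun hvC => hC0 v hvC hv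
  have huC : u ∈ C := hCf u v hadj hu hv
  have hne : ∀ {w}, w ∈ C → w ≠ v := fun hw hwv => hvC (hwv ▸ hw)
  have hDeq : {w | w ∈ insert v C ∧ Function.update lev v j w < j} = {w | w ∈ C ∧ lev w < j} := by
    ext w
    by_cases hw : w = v
    · subst hw; simp [hvC]
    · simp [hw]
  -- On a level that starts a component nothing in `C` lies below `j`, so `v` must be a nonterminal.
  -- Otherwise, if `v` is a terminal, `u` itself is its neighbor below `j`.
  have hL' : ((∀ w ∈ insert v C, ¬ Function.update lev v j w < j) ∧ v ∉ R ∧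
      ∃ x, ∀ w ∈ R, lev w ≠ 0 → lev w = j → w = x) ∨
      ∀ w ∈ R, Function.update lev v j w = j → ∃ x ∈ C, lev x < j ∧ G.Adj x w := by
    rcases hL with ⟨h1, x, hx⟩ | h2
    · refine Or.inl ⟨?_, hor.resolve_right (h1 u huC), x, hx⟩
      intro w hw
      by_cases hwv : w = v
      · subst hwv; simp
      · rw [Function.update_of_ne hwv]; exact h1 w (hw.resolve_left hwv)
    · right
      intro w hwR hw
      by_cases hwv : w = v
      · subst hwv
        exact ⟨u, huC, hor.resolve_left (fun h => h hwR), hadj⟩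
      · rw [Function.update_of_ne hwv] at hw
        exact h2 w hwR (hw ▸ hj) hw
  refine ⟨?_, ?_, ?_, ?_, ?_, insert v C, ?_, preconnected_induce_insert hC huC hadj, ?_, ?_, ?_⟩
  · intro w
    by_cases hw : w = v
    · subst hw; simp
    · simpa [hw] using h.le w
  · rw [ncard_visited_update hv hj]
    exact h.count.trans (Nat.le_succ _)
  · intro a b hab ha hlt
    by_cases hav : a = v
    · subst hav
      have hb := h.le b
      rw [Function.update_self, Function.update_of_ne hab.ne'] at hlt
      omega
    · rw [Function.update_of_ne hav] at ha hlt ⊢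
      by_cases hbv : b = v
      · subst hbv
        rw [Function.update_self] at hlt ⊢
        have := h.frontier a b hab ha hv
        rcases this with h1 | h1
        · omega
        · exact ⟨h1.2, h1.1.symm⟩
      · rw [Function.update_of_ne hbv] at hlt ⊢
        exact h.edge a b hab ha hlt
  · intro a b hab ha hb
    by_cases hbv : b = v
    · subst hbv; simp [hj] at hb
    · rw [Function.update_of_ne hbv] at hb
      by_cases hav : a = v
      · subst hav; simp
      · rw [Function.update_of_ne hav] at ha ⊢
        exact h.frontier a b hab ha hb
  · intro i hi
    by_cases hchange : i = j ∧ v ∈ R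
    · obtain ⟨rfl, hvR⟩ := hchange
      have hall := hL'.resolve_left (fun hl => hl.2.1 hvR)
      obtain ⟨x, hx, hxj, _⟩ := hall v hvR (by simp)
      by_contra hcard
      -- All terminals of the level become leaves attached to the lower part of `C`. Already `r` of
      -- them would do; the bound `r + 1` leaves room for the first terminal of a level, which is
      -- accepted without this argument.
      refine hG (hasDecoratedSubtree_of_connected (D := {w | w ∈ C ∧ lev w < i})
        (L := {w | w ∈ R ∧ Function.update lev v i w = i}) ?_ (fun w hw => hw.1) ?_ ?_ (by omega))
      · have : Nonempty ↥{w | w ∈ C ∧ lev w < i} := ⟨⟨x, hx, hxj⟩⟩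
        exact ⟨hD⟩
      · rw [Set.disjoint_left]
        rintro w ⟨hwC, hwi⟩ ⟨_, hw⟩
        rw [Function.update_of_ne (hne hwC)] at hw
        omega
      · rintro w ⟨hwR, hw⟩
        obtain ⟨y, hy, hyj, hyw⟩ := hall w hwR hw
        exact ⟨y, ⟨hy, hyj⟩, hyw⟩
    · refine le_trans (le_of_eq ?_) (h.small i hi)
      congr 1
      ext w
      by_cases hw : w = v
      · subst hw
        simp only [Set.mem_ofPred_eq, Function.update_self, hv]
        constructor
        · rintro ⟨h1, h2⟩; exact absurd ⟨h2.symm, h1⟩ hchange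
        · rintro ⟨_, h2⟩; exact absurd h2.symm hi
      · simp [hw]
  · intro w hw
    by_cases hwv : w = v
    · subst hwv; simpa using hj
    · rw [Function.update_of_ne hwv]; exact hC0 w (hw.resolve_left hwv)
  · rw [hDeq]; exact hD
  · intro a b hab ha hb
    by_cases hbv : b = v
    · subst hbv; simp [hj] at hb
    · rw [Function.update_of_ne hbv] at hb
      by_cases hav : a = v
      · exact Or.inl hav
      · rw [Function.update_of_ne hav] at ha
        exact Or.inr (hCf a b hab ha hb)
  · rcases hL' with ⟨h1, hvR, x, hx⟩ | h2
    · refine Or.inl ⟨h1, x, fun w hwR hw0 hw => ?_⟩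
      have hwv : w ≠ v := fun e => hvR (e ▸ hwR)
      rw [Function.update_of_ne hwv] at hw0 hw
      exact hx w hwR hw0 hw
    · refine Or.inr fun w hwR _ hw => ?_
      obtain ⟨x, hx, hxj, hxw⟩ := h2 w hwR hw
      refine ⟨x, Or.inr hx, ?_, hxw⟩
      rwa [Function.update_of_ne (hne hx)]

/-- Starting a new level with a terminal `v`: the part of the argument that does not depend on
whether `v` has a visited neighbor. -/
theorem next_aux [DecidableEq V] (h : IsLayering G R r lev j)
    (hnone : ∀ a b, ¬ SameLevel G R lev j a b) {v : V} (hv : lev v = 0) (hvR : v ∈ R)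
    (hreg : ∃ C : Set V, (∀ w ∈ C, w = v ∨ lev w ≠ 0) ∧ (G.induce C).Preconnected ∧
      (G.induce {w | w ∈ C ∧ w ≠ v}).Preconnected ∧ v ∈ C ∧
      (∀ a b, G.Adj a b → lev a ≠ 0 → lev b = 0 → b ≠ v → a ∈ C) ∧
      ((∀ w ∈ C, w = v) ∨ ∃ w ∈ C, w ≠ v ∧ G.Adj w v)) :
    IsLayering G R r (Function.update lev v (j + 1)) (j + 1) := by
  -- With the current level exhausted, edges leaving the visited set start exactly on level `j` and
  -- end in terminals. This makes levels grow by one along edges into `v`.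
  have hold : ∀ a b, G.Adj a b → lev a ≠ 0 → lev b = 0 → lev a = j ∧ b ∈ R := by
    intro a b hab ha hb
    have := hnone a b
    have hle := h.le a
    unfold SameLevel at this
    by_cases hbR : b ∈ R
    · refine ⟨?_, hbR⟩
      by_contra hne
      exact this ⟨hab, ha, hb, Or.inr (by omega)⟩
    · exact absurd ⟨hab, ha, hb, Or.inl hbR⟩ this
  have htop : ∀ w, Function.update lev v (j + 1) w = j + 1 → w = v := by
    intro w hw
    by_contra hwv
    rw [Function.update_of_ne hwv] at hw
    have := h.le w
    omega
  obtain ⟨C, hC0, hC, hD, hvC, hCf, hL⟩ := hreg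
  have hlt : ∀ w, Function.update lev v (j + 1) w < j + 1 ↔ w ≠ v := by
    intro w
    by_cases hw : w = v
    · subst hw; simp
    · rw [Function.update_of_ne hw]
      have := h.le w
      simp only [ne_eq, hw, not_false_eq_true, iff_true]
      omega
  refine ⟨?_, ?_, ?_, ?_, ?_, C, ?_, hC, ?_, ?_, ?_⟩
  · intro w
    by_cases hw : w = v
    · subst hw; simp
    · rw [Function.update_of_ne hw]; exact (h.le w).trans (Nat.le_succ _)
  · rw [ncard_visited_update hv (Nat.succ_ne_zero _)]
    exact Nat.succ_le_succ h.count
  · intro a b hab ha hl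
    by_cases hav : a = v
    · subst hav
      have hb := h.le b
      rw [Function.update_self, Function.update_of_ne hab.ne'] at hl
      omega
    · rw [Function.update_of_ne hav] at ha hl ⊢
      by_cases hbv : b = v
      · subst hbv
        rw [Function.update_self]
        exact ⟨hvR, by rw [(hold a b hab ha hv).1]⟩
      · rw [Function.update_of_ne hbv] at hl ⊢
        exact h.edge a b hab ha hl
  · intro a b hab ha hb
    by_cases hbv : b = v
    · subst hbv; simp at hb
    · rw [Function.update_of_ne hbv] at hb
      by_cases hav : a = v
      · subst hav; simp
      · rw [Function.update_of_ne hav] at ha ⊢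
        have := hold a b hab ha hb
        exact Or.inr ⟨by rw [this.1], this.2⟩
  · intro i hi
    by_cases hij : i = j + 1
    · subst hij
      refine (Set.ncard_le_ncard (t := {v}) (fun w hw => htop w hw.2) (Set.toFinite _)).trans ?_
      simp
    · refine le_trans (Set.ncard_le_ncard ?_ (Set.toFinite _)) (h.small i hi)
      rintro w ⟨hwR, hw⟩
      by_cases hwv : w = v
      · subst hwv; rw [Function.update_self] at hw; exact absurd hw.symm hij
      · rw [Function.update_of_ne hwv] at hw; exact ⟨hwR, hw⟩
  · intro w hw
    by_cases hwv : w = v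
    · subst hwv; simp
    · rw [Function.update_of_ne hwv]; exact (hC0 w hw).resolve_left hwv
  · have hset : {w | w ∈ C ∧ Function.update lev v (j + 1) w < j + 1} = {w | w ∈ C ∧ w ≠ v} :=
      Set.ext fun w => and_congr_right fun _ => hlt w
    rw [hset]
    exact hD
  · intro a b hab ha hb
    by_cases hbv : b = v
    · subst hbv; simp at hb
    · rw [Function.update_of_ne hbv] at hb
      by_cases hav : a = v
      · subst hav; exact hvC
      · rw [Function.update_of_ne hav] at ha
        exact hCf a b hab ha hb hbv
  · rcases hL with h1 | ⟨w, hw, hwv, hadj⟩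
    · exact Or.inl ⟨fun w hw hw' => (hlt w).1 hw' (h1 w hw), v, fun w _ _ hw => htop w hw⟩
    · refine Or.inr fun x _ _ hx => ⟨w, hw, (hlt w).2 hwv, ?_⟩
      rw [htop x hx]
      exact hadj

/-- The whole old region lies below the new level, so it becomes the connected lower part to which
further terminals of level `j + 1` attach. -/
theorem next [DecidableEq V] (h : IsLayering G R r lev j)
    (hnone : ∀ a b, ¬ SameLevel G R lev j a b) {u v : V} (hadj : G.Adj u v) (hu : lev u ≠ 0)
    (hv : lev v = 0) : IsLayering G R r (Function.update lev v (j + 1)) (j + 1) := by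
  have hvR : v ∈ R := by
    by_contra hvR
    exact hnone u v ⟨hadj, hu, hv, Or.inl hvR⟩
  obtain ⟨C, hC0, hC, -, hCf, -⟩ := h.region
  have hvC : v ∉ C := fun hvC => hC0 v hvC hv
  have huC : u ∈ C := hCf u v hadj hu hv
  have hset : {w | w ∈ insert v C ∧ w ≠ v} = C := by
    ext w
    by_cases hw : w = v
    · subst hw; simp [hvC]
    · simp [hw]
  refine h.next_aux hnone hv hvR ⟨insert v C, ?_, preconnected_induce_insert hC huC hadj, ?_,
    Or.inl rfl, ?_, Or.inr ⟨u, Or.inr huC, hadj.ne, hadj⟩⟩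
  · exact fun w hw => hw.imp id (hC0 w)
  · rw [hset]; exact hC
  · exact fun a b hab ha hb _ => Or.inr (hCf a b hab ha hb)

/-- No visited vertex can still be extended, so the old region may be dropped for `{v}`. Its lower
part is empty, which is why the regions are only required to be preconnected. -/
theorem root [DecidableEq V] (h : IsLayering G R r lev j)
    (hnone : ∀ a b, G.Adj a b → lev a ≠ 0 → lev b ≠ 0) {v : V} (hv : lev v = 0) (hvR : v ∈ R) :
    IsLayering G R r (Function.update lev v (j + 1)) (j + 1) := by
  refine h.next_aux (fun a b hab => hnone a b hab.1 hab.2.1 hab.2.2.1) hv hvR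
    ⟨{v}, fun w hw => Or.inl hw, ?_, ?_, rfl, ?_, Or.inl fun w hw => hw⟩
  · rintro ⟨a, rfl⟩ ⟨b, rfl⟩
    exact SimpleGraph.Reachable.refl _
  · rintro ⟨a, ha, ha'⟩
    exact absurd ha ha'
  · exact fun a b hab ha hb _ => absurd hb (hnone a b hab ha)

end IsLayering

/-- All terminals are visited, and the set of visited vertices is a union of components. -/
def IsFinished {V : Type*} (G : SimpleGraph V) (R : Set V) (lev : V → ℕ) : Prop :=
  (∀ v ∈ R, lev v ≠ 0) ∧ ∀ u v, G.Adj u v → lev u ≠ 0 → lev v ≠ 0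

/-- Each step visits a new vertex, and more than `Nat.card V` vertices cannot be visited. This
abstract run of the search serves arbitrary finite vertex types, where no program is involved. -/
theorem IsLayering.exists_isFinished {V : Type*} [Finite V] {G : SimpleGraph V} {R : Set V} {r : ℕ}
    (hG : ¬ HasDecoratedSubtree G R r) :
    ∃ (lev : V → ℕ) (j : ℕ), IsLayering G R r lev j ∧ IsFinished G R lev := by
  classical
  have key : ∀ k, k ≤ Nat.card V + 1 → ∃ (lev : V → ℕ) (j : ℕ), IsLayering G R r lev j ∧
      (IsFinished G R lev ∨ k ≤ {v | lev v ≠ 0}.ncard) := by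
    intro k
    induction k with
    | zero => exact fun _ => ⟨_, 0, IsLayering.zero, Or.inr (Nat.zero_le _)⟩
    | succ k ih =>
      intro hk
      obtain ⟨lev, j, h, hfin | hcard⟩ := ih (by omega)
      · exact ⟨lev, j, h, Or.inl hfin⟩
      by_cases hs : ∃ u v, SameLevel G R lev j u v
      · obtain ⟨u, v, huv⟩ := hs
        refine ⟨_, _, h.same hG huv, Or.inr ?_⟩
        rw [IsLayering.ncard_visited_update huv.2.2.1
          (fun h0 => huv.2.1 (Nat.le_zero.1 (h0 ▸ h.le u)))]
        omega
      push Not at hs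
      by_cases hn : ∃ u v, G.Adj u v ∧ lev u ≠ 0 ∧ lev v = 0
      · obtain ⟨u, v, huv, hu, hv⟩ := hn
        refine ⟨_, _, h.next hs huv hu hv, Or.inr ?_⟩
        rw [IsLayering.ncard_visited_update hv (Nat.succ_ne_zero _)]
        omega
      push Not at hn
      by_cases hr : ∃ v ∈ R, lev v = 0
      · obtain ⟨v, hvR, hv⟩ := hr
        refine ⟨_, _, h.root hn hv hvR, Or.inr ?_⟩
        rw [IsLayering.ncard_visited_update hv (Nat.succ_ne_zero _)]
        omega
      push Not at hr
      exact ⟨lev, j, h, Or.inl ⟨hr, hn⟩⟩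
  obtain ⟨lev, j, h, hfin | hcard⟩ := key _ le_rfl
  · exact ⟨lev, j, h, hfin⟩
  · have := Set.ncard_le_card {v | lev v ≠ 0}
    omega

/-! ## The decomposition of a level function -/

/-- The caterpillar with spine `0, 2, 4, …` in which `2 * i + 1` is a leaf at `2 * i`. -/
def caterpillar (m : ℕ) : SimpleGraph (Fin m) where
  Adj a b := (a.1 ≠ 0 ∧ b.1 = 2 * ((a.1 - 1) / 2)) ∨ (b.1 ≠ 0 ∧ a.1 = 2 * ((b.1 - 1) / 2))
  symm := ⟨fun _ _ h => h.symm⟩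
  loopless := ⟨fun a h => by omega⟩

theorem caterpillar_adj {m : ℕ} {a b : Fin m} : (caterpillar m).Adj a b ↔
    (a.1 ≠ 0 ∧ b.1 = 2 * ((a.1 - 1) / 2)) ∨ (b.1 ≠ 0 ∧ a.1 = 2 * ((b.1 - 1) / 2)) := Iff.rfl

theorem connected_induce_caterpillar {m : ℕ} {S : Set (Fin m)} {t₀ : Fin m} (h₀ : t₀ ∈ S)
    (hS : ∀ t ∈ S, t ≠ t₀ → t.1 ≠ 0 ∧ ∃ p ∈ S, p.1 = 2 * ((t.1 - 1) / 2)) :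
    ((caterpillar m).induce S).Connected := by
  rw [SimpleGraph.connected_iff_exists_forall_reachable]
  refine ⟨⟨t₀, h₀⟩, ?_⟩
  have key : ∀ k, ∀ t (ht : t ∈ S), t.1 = k →
      ((caterpillar m).induce S).Reachable ⟨t₀, h₀⟩ ⟨t, ht⟩ := by
    intro k
    induction k using Nat.strong_induction_on with
    | _ k ih =>
      intro t ht htk
      by_cases htt : t = t₀
      · subst htt; exact SimpleGraph.Reachable.refl _
      · obtain ⟨h0, p, hp, hpt⟩ := hS t ht htt
        refine (ih p.1 (by omega) p hp rfl).trans (SimpleGraph.Adj.reachable ?_)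
        exact Or.inr ⟨h0, hpt⟩
  exact fun t => key _ t.1 t.2 rfl

/-- Every nonzero vertex has exactly one smaller neighbor, so the largest vertex of a cycle cannot
have two distinct neighbors on it. -/
theorem isTree_caterpillar (m : ℕ) (hm : 0 < m) : (caterpillar m).IsTree := by
  refine ⟨?_, ?_⟩
  · rw [← (SimpleGraph.induceUnivIso (caterpillar m)).connected_iff]
    refine connected_induce_caterpillar (t₀ := ⟨0, hm⟩) (Set.mem_univ _) fun t _ ht => ?_
    have ht0 : t.1 ≠ 0 := fun h => ht (Fin.ext h)
    exact ⟨ht0, ⟨2 * ((t.1 - 1) / 2), by omega⟩, Set.mem_univ _, rfl⟩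
  · intro v p hp
    obtain ⟨u, hu, hmax⟩ := Finset.exists_max_image p.support.toFinset id
      ⟨v, by simp⟩
    have hu' : u ∈ p.support := by simpa using hu
    have hq : (p.rotate u hu').IsCycle := SimpleGraph.Walk.IsCycle.rotate hu' hp
    have hmem : ∀ w, w ∈ (p.rotate _ hu').support → w ≤ u := by
      intro w hw
      exact hmax w (by simpa [SimpleGraph.Walk.mem_support_rotate_iff] using hw)
    have h1 := (p.rotate _ hu').adj_snd hq.not_nil
    have h2 := (p.rotate _ hu').adj_penultimate hq.not_nil
    have l1 := hmem _ ((p.rotate _ hu').getVert_mem_support 1)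
    have l2 := hmem _ ((p.rotate _ hu').getVert_mem_support ((p.rotate _ hu').length - 1))
    have hne := hq.snd_ne_penultimate
    rw [caterpillar_adj] at h1 h2
    refine hne (Fin.ext ?_)
    change (p.rotate _ hu').snd ≤ u at l1
    change (p.rotate _ hu').penultimate ≤ u at l2
    rw [Fin.le_def] at l1 l2
    omega

/-- The bags: the terminals of the levels `i` and `i + 1` are in the bags of `2 * i` and
`2 * i + 1`, and the latter also contains the nonterminals of level `i`. -/
def levelBag {V : Type*} (R : Set V) (lev : V → ℕ) (t : ℕ) : Set V :=
  {v | (v ∈ R ∧ (t = 2 * lev v ∨ t = 2 * lev v + 1 ∨ t + 2 = 2 * lev v ∨ t + 1 = 2 * lev v)) ∨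
    (v ∉ R ∧ t = 2 * lev v + 1)}

/-- An edge of `G` lies in the leaf bag of its lower end, and every edge of the caterpillar has an
even end, whose bag consists of the terminals of two levels. Allowing `j ≤ n` lets the tree depend
on the number of vertices alone; surplus bags are harmless. -/
theorem IsLayering.isRefinedDecomposition {V : Type*} [Finite V] {G : SimpleGraph V} {R : Set V}
    {r j n : ℕ} {lev : V → ℕ} (h : IsLayering G R r lev j) (hfin : IsFinished G R lev)
    (hn : j ≤ n) : IsRefinedDecomposition G R (2 * r + 3) (caterpillar (2 * n + 2))
      (fun t => levelBag R lev t.1) := by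
  have hle : ∀ v, lev v ≤ n := fun v => (h.le v).trans hn
  have hterm : ∀ i, ({v | v ∈ R ∧ (lev v = i ∨ lev v = i + 1)} : Set V).ncard ≤ 2 * r + 3 := by
    intro i
    have hlev : ∀ i, ({v | v ∈ R ∧ lev v = i} : Set V).ncard ≤ r + 1 := by
      intro i
      rcases eq_or_ne i 0 with rfl | hi
      · rw [(Set.eq_empty_iff_forall_notMem (s := {v | v ∈ R ∧ lev v = 0})).2
          fun v hv => hfin.1 v hv.1 hv.2]
        simp
      · exact h.small i hi
    have hsub : ({v | v ∈ R ∧ (lev v = i ∨ lev v = i + 1)} : Set V) =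
        {v | v ∈ R ∧ lev v = i} ∪ {v | v ∈ R ∧ lev v = i + 1} := by
      ext v; simp only [Set.mem_ofPred_eq, Set.mem_union]; tauto
    rw [hsub]
    have := Set.ncard_union_le {v | v ∈ R ∧ lev v = i} {v | v ∈ R ∧ lev v = i + 1}
    have h1 := hlev i
    have h2 := hlev (i + 1)
    omega
  have heven : ∀ i, levelBag R lev (2 * i) = {v | v ∈ R ∧ (lev v = i ∨ lev v = i + 1)} := by
    intro i
    ext v
    simp only [levelBag, Set.mem_ofPred_eq]
    constructor
    · rintro (⟨h1, h2⟩ | ⟨_, h2⟩)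
      · exact ⟨h1, by omega⟩
      · omega
    · rintro ⟨h1, h2⟩
      exact Or.inl ⟨h1, by omega⟩
  have hsmall : ∀ t, t % 2 = 0 → (levelBag R lev t).ncard ≤ 2 * r + 3 := by
    intro t ht
    obtain ⟨i, rfl⟩ : ∃ i, t = 2 * i := ⟨t / 2, by omega⟩
    rw [heven]
    exact hterm i
  refine ⟨⟨isTree_caterpillar _ (by omega), ?_, ?_, ?_⟩, ?_, ?_, ?_⟩
  · intro v
    refine ⟨⟨2 * lev v + 1, by have := hle v; omega⟩, ?_⟩
    by_cases hv : v ∈ R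
    · exact Or.inl ⟨hv, Or.inr (Or.inl rfl)⟩
    · exact Or.inr ⟨hv, rfl⟩
  · have key : ∀ u v, G.Adj u v → lev u ≤ lev v →
        ∃ t : Fin (2 * n + 2), u ∈ levelBag R lev t.1 ∧ v ∈ levelBag R lev t.1 := by
      intro u v huv hl
      refine ⟨⟨2 * lev u + 1, by have := hle u; omega⟩, ?_, ?_⟩
      · by_cases hu : u ∈ R
        · exact Or.inl ⟨hu, Or.inr (Or.inl rfl)⟩
        · exact Or.inr ⟨hu, rfl⟩
      · rcases hl.eq_or_lt with he | hlt
        · by_cases hv : v ∈ R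
          · exact Or.inl ⟨hv, Or.inr (Or.inl (by simp only [he]))⟩
          · exact Or.inr ⟨hv, by simp only [he]⟩
        · have hu : lev u ≠ 0 := hfin.2 v u huv.symm (by omega)
          obtain ⟨hvR, hv⟩ := h.edge u v huv hu hlt
          exact Or.inl ⟨hvR, by simp only; omega⟩
    intro u v huv
    rcases le_total (lev u) (lev v) with hl | hl
    · exact key u v huv hl
    · obtain ⟨t, h1, h2⟩ := key v u huv.symm hl
      exact ⟨t, h2, h1⟩
  · intro v
    have hlv := hle v
    by_cases hv : v ∈ R
    · have h0 := hfin.1 v hv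
      -- The four bags of a terminal of level `l` are those of `2 * l - 2` to `2 * l + 1`. As `l` is
      -- positive, the least is a genuine index, and it is the root of their subtree.
      refine connected_induce_caterpillar (t₀ := ⟨2 * lev v - 2, by omega⟩)
        (Or.inl ⟨hv, by simp only; omega⟩) ?_
      rintro t (⟨_, ht⟩ | ⟨hv', _⟩) hne
      · have hne' : t.1 ≠ 2 * lev v - 2 := fun e => hne (Fin.ext e)
        refine ⟨by omega, ⟨2 * ((t.1 - 1) / 2), by omega⟩, Or.inl ⟨hv, ?_⟩, rfl⟩
        simp only
        omega
      · exact absurd hv hv'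
    · refine connected_induce_caterpillar (t₀ := ⟨2 * lev v + 1, by omega⟩)
        (Or.inr ⟨hv, rfl⟩) ?_
      rintro t (⟨hv', _⟩ | ⟨_, ht⟩) hne
      · exact absurd hv' hv
      · exact absurd (Fin.ext ht) hne
  · intro t t' htt
    rw [caterpillar_adj] at htt
    by_cases ht : t.1 % 2 = 0
    · exact (Set.ncard_le_ncard Set.inter_subset_left (Set.toFinite _)).trans (hsmall _ ht)
    · exact (Set.ncard_le_ncard Set.inter_subset_right (Set.toFinite _)).trans
        (hsmall _ (by omega))
  · intro t
    have hsub : (fun s : Fin (2 * n + 2) => s.1) '' ((caterpillar (2 * n + 2)).neighborSet t) ⊆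
        ({2 * ((t.1 - 1) / 2), t.1 + 1, t.1 + 2} : Finset ℕ) := by
      rintro _ ⟨s, hs, rfl⟩
      rw [SimpleGraph.mem_neighborSet, caterpillar_adj] at hs
      simp only [Finset.coe_insert, Finset.coe_singleton, Set.mem_insert_iff,
        Set.mem_singleton_iff]
      omega
    rw [← Set.ncard_image_of_injective _ Fin.val_injective]
    refine (Set.ncard_le_ncard hsub (Finset.finite_toSet _)).trans ?_
    rw [Set.ncard_coe_finset]
    exact Finset.card_le_three.trans (by omega)
  · intro t
    by_cases ht : t.1 % 2 = 0
    · exact Or.inl (hsmall _ ht)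
    · have hadj : (caterpillar (2 * n + 2)).Adj t ⟨2 * ((t.1 - 1) / 2), by omega⟩ :=
        Or.inl ⟨by omega, rfl⟩
      refine Or.inr ⟨Set.ncard_eq_one.2 ⟨_, Set.eq_singleton_iff_unique_mem.2
        ⟨hadj, fun s hs => Fin.ext ?_⟩⟩, _, hadj, ?_⟩
      · rw [SimpleGraph.mem_neighborSet, caterpillar_adj] at hs
        simp only
        omega
      · rintro v ⟨⟨hv, h1⟩ | ⟨hv, _⟩, hvR⟩
        · exact Or.inl ⟨hv, by simp only; omega⟩
        · exact absurd hvR hv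

end Decorated

namespace RAM

/-! ## A program logic with running times -/

namespace State

theorem setReg_reg_self (s : State) (x c : ℕ) : (s.setReg x c).reg x = c :=
  Function.update_self ..

theorem setReg_reg_of_ne (s : State) {x y : ℕ} (c : ℕ) (h : y ≠ x) :
    (s.setReg x c).reg y = s.reg y := Function.update_of_ne h ..

theorem setReg_arr (s : State) (x c : ℕ) : (s.setReg x c).arr = s.arr := rfl

theorem setArr_reg (s : State) (a i j c : ℕ) : (s.setArr a i j c).reg = s.reg := rfl

theorem setArr_arr_self (s : State) (a i j c i' j' : ℕ) :
    (s.setArr a i j c).arr a i' j' = if i' = i ∧ j' = j then c else s.arr a i' j' := by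
  simp only [setArr, Function.update_self]
  by_cases hi : i' = i
  · subst hi
    by_cases hj : j' = j
    · subst hj; simp
    · simp [hj]
  · simp [hi]

theorem setArr_arr_of_ne (s : State) {a b : ℕ} (i j c : ℕ) (h : b ≠ a) :
    (s.setArr a i j c).arr b = s.arr b := Function.update_of_ne h ..

end State

/-- Started in `s`, the program `p` halts after at most `k` steps in a state that satisfies `Q`. -/
def Ensures (p : Prog) (s : State) (k : ℕ) (Q : State → Prop) : Prop :=
  ∃ l s', Runs p s l s' ∧ l ≤ k ∧ Q s'

namespace Ensures

variable {p q : Prog} {s : State} {k k' : ℕ} {Q Q' : State → Prop} {e : Expr}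

theorem mono (h : Ensures p s k Q) (hk : k ≤ k') (hQ : ∀ s', Q s' → Q' s') :
    Ensures p s k' Q' := by
  obtain ⟨l, s', hr, hl, hs⟩ := h
  exact ⟨l, s', hr, hl.trans hk, hQ s' hs⟩

theorem skip (h : Q s) : Ensures Prog.skip s 1 Q := ⟨1, s, Runs.skip s, le_rfl, h⟩

theorem assign {x : ℕ} (h : Q (s.setReg x (e.eval s))) :
    Ensures (Prog.assign x e) s (e.cost + 1) Q := ⟨_, _, Runs.assign s x e, le_rfl, h⟩

theorem store {a : ℕ} {i j : Expr} (h : Q (s.setArr a (i.eval s) (j.eval s) (e.eval s))) :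
    Ensures (Prog.store a i j e) s (i.cost + j.cost + e.cost + 1) Q :=
  ⟨_, _, Runs.store s a i j e, le_rfl, h⟩

theorem seq (hp : Ensures p s k Q) (hq : ∀ s', Q s' → Ensures q s' k' Q') :
    Ensures (Prog.seq p q) s (k + k') Q' := by
  obtain ⟨l, s', hr, hl, hs⟩ := hp
  obtain ⟨l', s'', hr', hl', hs'⟩ := hq s' hs
  exact ⟨_, _, Runs.seq hr hr', Nat.add_le_add hl hl', hs'⟩

theorem assign_seq {x : ℕ} (h : Ensures q (s.setReg x (e.eval s)) k Q) :
    Ensures (Prog.seq (Prog.assign x e) q) s (e.cost + 1 + k) Q :=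
  (assign (Q := fun s' => s' = s.setReg x (e.eval s)) rfl).seq fun _ hs => hs ▸ h

theorem store_seq {a : ℕ} {i j : Expr}
    (h : Ensures q (s.setArr a (i.eval s) (j.eval s) (e.eval s)) k Q) :
    Ensures (Prog.seq (Prog.store a i j e) q) s (i.cost + j.cost + e.cost + 1 + k) Q :=
  (store (Q := fun s' => s' = s.setArr a (i.eval s) (j.eval s) (e.eval s)) rfl).seq
    fun _ hs => hs ▸ h

theorem branch (hp : e.eval s ≠ 0 → Ensures p s k Q) (hq : e.eval s = 0 → Ensures q s k' Q) :
    Ensures (Prog.branch e p q) s (e.cost + 1 + (k + k')) Q := by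
  by_cases he : e.eval s = 0
  · obtain ⟨l, s', hr, hl, hs⟩ := hq he
    exact ⟨_, _, Runs.branch_eq he hr, by omega, hs⟩
  · obtain ⟨l, s', hr, hl, hs⟩ := hp he
    exact ⟨_, _, Runs.branch_ne he hr, by omega, hs⟩

end Ensures

/-- `for x < N do p` -/
def Prog.forLoop (x : ℕ) (N : Expr) (p : Prog) : Prog :=
  Prog.seq (Prog.assign x (Expr.const 0)) (Prog.loop (Expr.sub N (Expr.reg x))
    (Prog.seq p (Prog.assign x (Expr.add (Expr.reg x) (Expr.const 1)))))

/-- A round costs `N.cost + 3` for the test, at most `k` for the body and `4` for the increment. The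
failing last test is charged as one more round, and the initial assignment costs `2`. -/
theorem Ensures.forLoop {x : ℕ} {N : Expr} {p : Prog} {s : State} {k n : ℕ}
    (I : ℕ → State → Prop) (h0 : I 0 (s.setReg x 0))
    (hI : ∀ i s, I i s → s.reg x = i ∧ N.eval s = n)
    (step : ∀ i, i < n → ∀ s, I i s →
      Ensures p s k (fun s' => s'.reg x = i ∧ I (i + 1) (s'.setReg x (i + 1)))) :
    Ensures (Prog.forLoop x N p) s (2 + (N.cost + k + 7) * (n + 1)) (I n) := by
  refine Ensures.assign_seq (e := Expr.const 0) ?_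
  have key : ∀ d i s, i + d = n → I i s → Ensures (Prog.loop (Expr.sub N (Expr.reg x))
      (Prog.seq p (Prog.assign x (Expr.add (Expr.reg x) (Expr.const 1))))) s
      ((N.cost + k + 7) * (d + 1)) (I n) := by
    intro d
    induction d with
    | zero =>
      intro i s hi h
      have he : (Expr.sub N (Expr.reg x)).eval s = 0 := by
        obtain ⟨h1, h2⟩ := hI i s h
        simp only [Expr.eval, h1, h2]
        omega
      refine ⟨_, s, Runs.loop_eq he, ?_, ?_⟩
      · simp only [Expr.cost]; omega
      · obtain rfl : i = n := by omega
        exact h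
    | succ d ih =>
      intro i s hi h
      have he : (Expr.sub N (Expr.reg x)).eval s ≠ 0 := by
        obtain ⟨h1, h2⟩ := hI i s h
        simp only [Expr.eval, h1, h2]
        omega
      obtain ⟨l, s', hr, hl, hx, hs⟩ := step i (by omega) s h
      have hr' := Runs.assign s' x (Expr.add (Expr.reg x) (Expr.const 1))
      have hev : (Expr.add (Expr.reg x) (Expr.const 1)).eval s' = i + 1 := by
        simp [Expr.eval, hx]
      rw [hev] at hr'
      obtain ⟨l', s'', hr'', hl', hs'⟩ := ih (i + 1) (s'.setReg x (i + 1)) (by omega) hs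
      refine ⟨_, s'', Runs.loop_ne he (Runs.seq hr hr') hr'', ?_, hs'⟩
      rw [Nat.mul_add_one (N.cost + k + 7) (d + 1)]
      simp only [Expr.cost]
      omega
  exact key n 0 _ (by omega) h0

/-! ## Searching for a pair of vertices -/

/-- Look for `u, v < reg 0`, held in the registers `4` and `5`, with `c ≠ 0`. If there are any,
register `6` becomes `v + 1` and register `7` becomes `y`. -/
def Prog.scan (c y : Expr) : Prog :=
  Prog.forLoop 4 (Expr.reg 0) (Prog.forLoop 5 (Expr.reg 0) (Prog.branch c
    (Prog.seq (Prog.assign 6 (Expr.add (Expr.reg 5) (Expr.const 1))) (Prog.assign 7 y)) Prog.skip))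

/-- The states agree except for the working registers of `Prog.scan`. -/
def ScanFrame (s s' : State) : Prop :=
  s'.arr = s.arr ∧ s'.reg 0 = s.reg 0 ∧ s'.reg 3 = s.reg 3 ∧ s'.reg 8 = s.reg 8

theorem ScanFrame.trans {s s' s'' : State} (h : ScanFrame s s') (h' : ScanFrame s' s'') :
    ScanFrame s s'' :=
  ⟨h'.1.trans h.1, h'.2.1.trans h.2.1, h'.2.2.1.trans h.2.2.1, h'.2.2.2.trans h.2.2.2⟩

theorem ScanFrame.setReg {s s' : State} (h : ScanFrame s s') {x : ℕ} (c : ℕ) (h0 : 0 ≠ x)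
    (h3 : 3 ≠ x) (h8 : 8 ≠ x) : ScanFrame s (s'.setReg x c) := by
  refine ⟨h.1, ?_, ?_, ?_⟩
  · rw [State.setReg_reg_of_ne _ _ h0]; exact h.2.1
  · rw [State.setReg_reg_of_ne _ _ h3]; exact h.2.2.1
  · rw [State.setReg_reg_of_ne _ _ h8]; exact h.2.2.2

/-- The invariant `J i k` says that either no pair lexicographically before `(i, k)` satisfies `P`,
or some hit has been recorded. Which hit is kept does not matter. -/
theorem ensures_scan {c y : Expr} {s : State} {n m : ℕ} {P : ℕ → ℕ → Prop} (hn : s.reg 0 = n)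
    (hc : ∀ s', ScanFrame s s' → (c.eval s' ≠ 0 ↔ P (s'.reg 4) (s'.reg 5)))
    (hy : ∀ s', ScanFrame s s' → y.eval s' = m) :
    Ensures (Prog.scan c y) s
      (2 + (1 + (2 + (1 + (c.cost + 1 + (4 + (y.cost + 1) + 1)) + 7) * (n + 1)) + 7) * (n + 1))
      (fun s' => ScanFrame s s' ∧
        (((∀ u < n, ∀ v < n, ¬ P u v) ∧ s'.reg 6 = s.reg 6 ∧ s'.reg 7 = s.reg 7) ∨
          ∃ u < n, ∃ v < n, P u v ∧ s'.reg 6 = v + 1 ∧ s'.reg 7 = m)) := by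
  let J : ℕ → ℕ → State → Prop := fun i k s' => ScanFrame s s' ∧
    (((∀ u < n, ∀ v < n, (u < i ∨ (u = i ∧ v < k)) → ¬ P u v) ∧
      s'.reg 6 = s.reg 6 ∧ s'.reg 7 = s.reg 7) ∨
      ∃ u < n, ∃ v < n, P u v ∧ s'.reg 6 = v + 1 ∧ s'.reg 7 = m)
  have hJ : ∀ {i k s'} (x c : ℕ), J i k s' → 0 ≠ x → 3 ≠ x → 6 ≠ x → 7 ≠ x → 8 ≠ x →
      J i k (s'.setReg x c) := by
    rintro i k s' x c ⟨h, h'⟩ h0 h3 h6 h7 h8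
    refine ⟨h.setReg c h0 h3 h8, ?_⟩
    simpa only [State.setReg_reg_of_ne _ _ h6, State.setReg_reg_of_ne _ _ h7] using h'
  have hJnext : ∀ {i s'}, J i n s' → J (i + 1) 0 s' := by
    rintro i s' ⟨h, h'⟩
    refine ⟨h, h'.imp_left fun h1 => ⟨fun u hu v hv huv => h1.1 u hu v hv (by omega), h1.2⟩⟩
  refine (Ensures.forLoop (fun i s' => s'.reg 4 = i ∧ J i 0 s') ?_ ?_ ?_).mono le_rfl ?_
  · refine ⟨State.setReg_reg_self .., hJ _ _ ⟨⟨rfl, rfl, rfl, rfl⟩, Or.inl ⟨?_, rfl, rfl⟩⟩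
      (by decide) (by decide) (by decide) (by decide) (by decide)⟩
    intro u _ v _ huv
    omega
  · rintro i s' ⟨h4, h⟩
    exact ⟨h4, h.1.2.1.trans hn⟩
  · rintro i hi s1 ⟨h4, h⟩
    refine (Ensures.forLoop (fun k s' => s'.reg 5 = k ∧ s'.reg 4 = i ∧ J i k s')
      ?_ ?_ ?_).mono le_rfl ?_
    · refine ⟨State.setReg_reg_self .., ?_, hJ _ _ h (by decide) (by decide) (by decide)
        (by decide) (by decide)⟩
      rw [State.setReg_reg_of_ne _ _ (by decide)]; exact h4
    · rintro k s' ⟨h5, _, h⟩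
      exact ⟨h5, h.1.2.1.trans hn⟩
    · rintro k hk s2 ⟨h5, h4, hfr, hres⟩
      have hfr6 := hfr.setReg (x := 6) (k + 1) (by decide) (by decide) (by decide)
      refine Ensures.branch (fun he => ?_) (fun he => ?_)
      · refine Ensures.assign_seq (Ensures.assign ?_)
        have h51 : (Expr.add (Expr.reg 5) (Expr.const 1)).eval s2 = k + 1 := by
          simp [Expr.eval, h5]
        rw [h51, hy _ hfr6]
        refine ⟨?_, State.setReg_reg_self .., ?_, hJ _ _ ⟨?_, Or.inr ⟨i, hi, k, hk, ?_, ?_, ?_⟩⟩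
          (by decide) (by decide) (by decide) (by decide) (by decide)⟩
        · rw [State.setReg_reg_of_ne _ _ (by decide), State.setReg_reg_of_ne _ _ (by decide), h5]
        · rw [State.setReg_reg_of_ne _ _ (by decide), State.setReg_reg_of_ne _ _ (by decide),
            State.setReg_reg_of_ne _ _ (by decide), h4]
        · exact hfr6.setReg _ (by decide) (by decide) (by decide)
        · have := (hc s2 hfr).1 he
          rwa [h4, h5] at this
        · rw [State.setReg_reg_of_ne _ _ (by decide), State.setReg_reg_self]
        · rw [State.setReg_reg_self]
      · refine Ensures.skip ⟨h5, State.setReg_reg_self .., ?_, hJ _ _ ⟨hfr, ?_⟩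
          (by decide) (by decide) (by decide) (by decide) (by decide)⟩
        · rw [State.setReg_reg_of_ne _ _ (by decide), h4]
        · refine hres.imp_left fun h1 => ⟨fun u hu v hv huv => ?_, h1.2⟩
          by_cases hnew : u = i ∧ v = k
          · obtain ⟨rfl, rfl⟩ := hnew
            intro hP
            rw [← h4, ← h5] at hP
            exact (hc s2 hfr).2 hP he
          · exact h1.1 u hu v hv (by omega)
    · rintro s2 ⟨_, h4, h⟩
      refine ⟨h4, State.setReg_reg_self .., hJ _ _ (hJnext h) (by decide) (by decide) (by decide)
        (by decide) (by decide)⟩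
  · rintro s' ⟨_, h, h'⟩
    exact ⟨h, h'.imp_left fun h1 => ⟨fun u hu v hv => h1.1 u hu v hv (Or.inl hu), h1.2⟩⟩

end RAM

namespace Decorated

open RAM

/-! ## The algorithm

Row `0` of array `4` holds the levels, register `8` the current level. -/

/-- The entry `lev u`, `u` in register `x`. -/
def levExpr (x : ℕ) : Expr := Expr.get 4 (Expr.const 0) (Expr.reg x)

/-- Nonzero iff register `5` is a terminal. -/
def termExpr : Expr := Expr.get 1 (Expr.const 0) (Expr.reg 5)

/-- Nonzero iff register `5` is an unvisited terminal. -/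
def rootExpr : Expr := Expr.sub termExpr (levExpr 5)

/-- Nonzero iff register `5` is an unvisited neighbor of the visited register `4`. -/
def nextExpr : Expr :=
  Expr.sub (Expr.sub (Expr.get 0 (Expr.reg 4) (Expr.reg 5)) (levExpr 5))
    (Expr.sub (Expr.const 1) (levExpr 4))

/-- Like `nextExpr`, but register `5` must be a nonterminal or register `4` of a smaller level than
the current one. -/
def sameExpr : Expr :=
  Expr.sub nextExpr (Expr.sub termExpr (Expr.sub (Expr.reg 8) (levExpr 4)))

/-- The next level. -/
def succExpr : Expr := Expr.add (Expr.reg 8) (Expr.const 1)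

/-- Visit one more vertex, if possible on the current level. -/
def visitProg : Prog :=
  Prog.seq (Prog.assign 6 (Expr.const 0)) (Prog.seq (Prog.scan rootExpr succExpr)
    (Prog.seq (Prog.scan nextExpr succExpr) (Prog.seq (Prog.scan sameExpr (Expr.reg 8))
      (Prog.branch (Expr.reg 6)
        (Prog.seq (Prog.assign 8 (Expr.reg 7))
          (Prog.store 4 (Expr.const 0) (Expr.sub (Expr.reg 6) (Expr.const 1)) (Expr.reg 8)))
        Prog.skip))))

/-- Write the edges of the caterpillar from `2 * i` to `2 * i + 1` and `2 * i + 2`, where `i` is in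
register `4`. -/
def edgeProg : Prog :=
  let a := Expr.add (Expr.reg 4) (Expr.reg 4)
  let b := Expr.add a (Expr.const 1)
  let c := Expr.add a (Expr.const 2)
  Prog.seq (Prog.store 2 a b (Expr.const 1)) (Prog.seq (Prog.store 2 b a (Expr.const 1))
    (Prog.seq (Prog.store 2 a c (Expr.const 1)) (Prog.store 2 c a (Expr.const 1))))

/-- Put the vertex in register `5` into the bags that contain it. -/
def bagProg : Prog :=
  let a := Expr.add (levExpr 5) (levExpr 5)
  let put := fun e : Expr => Prog.store 3 e (Expr.reg 5) (Expr.const 1)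
  Prog.branch termExpr
    (Prog.seq (put a) (Prog.seq (put (Expr.add a (Expr.const 1)))
      (Prog.seq (put (Expr.sub a (Expr.const 2))) (put (Expr.sub a (Expr.const 1))))))
    (put (Expr.add a (Expr.const 1)))

/-- The whole algorithm. -/
def decompositionProg : Prog :=
  Prog.seq (Prog.forLoop 3 (Expr.reg 0) visitProg)
    (Prog.seq (Prog.forLoop 4 (Expr.add (Expr.reg 0) (Expr.const 1)) edgeProg)
      (Prog.seq (Prog.forLoop 5 (Expr.reg 0) bagProg)
        (Prog.assign 2 (Expr.add (Expr.add (Expr.reg 0) (Expr.reg 0)) (Expr.const 2)))))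

/-! ### Correctness and running time of the search. -/

section Input

variable {n : ℕ} (G : SimpleGraph (Fin n)) (R : Set (Fin n)) (r : ℕ)

theorem inputState_adj (u v : Fin n) :
    (inputState G R r).arr 0 u v ≤ 1 ∧ ((inputState G R r).arr 0 u v ≠ 0 ↔ G.Adj u v) := by
  by_cases h : G.Adj u v <;> simp [inputState, h]

theorem inputState_term (v : Fin n) :
    (inputState G R r).arr 1 0 v ≤ 1 ∧ ((inputState G R r).arr 1 0 v ≠ 0 ↔ v ∈ R) := by
  by_cases h : v ∈ R <;> simp [inputState, h]

/-- The levels stored in a state. -/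
def levels (n : ℕ) (s : State) (v : Fin n) : ℕ := s.arr 4 0 v

/-- Invariant of the first loop. -/
structure VisitInv (i : ℕ) (s : State) : Prop where
  counter : s.reg 3 = i
  size : s.reg 0 = n
  adj : s.arr 0 = (inputState G R r).arr 0
  term : s.arr 1 = (inputState G R r).arr 1
  tree : ∀ t t', s.arr 2 t t' = 0
  bag : ∀ t t', s.arr 3 t t' = 0
  layering : IsLayering G R r (levels n s) (s.reg 8)
  progress : IsFinished G R (levels n s) ∨ i ≤ {v | levels n s v ≠ 0}.ncard

variable {G R r}

theorem VisitInv.of_frame {i : ℕ} {s s' : State} (h : VisitInv G R r i s) (hf : ScanFrame s s') :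
    VisitInv G R r i s' := by
  have hlev : levels n s' = levels n s := by unfold levels; rw [hf.1]
  obtain ⟨h1, h2, h3, h4, h5, h6, h7, h8⟩ := h
  obtain ⟨f1, f2, f3, f4⟩ := hf
  exact ⟨f3.trans h1, f2.trans h2, f1 ▸ h3, f1 ▸ h4, f1 ▸ h5, f1 ▸ h6, by rwa [hlev, f4],
    by rwa [hlev]⟩

theorem VisitInv.visit {i j : ℕ} {s : State} (h : VisitInv G R r i s) {v : Fin n}
    (hv : levels n s v = 0) (hj : j ≠ 0)
    (hnf : ¬ IsFinished G R (levels n s))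
    (hlay : IsLayering G R r (Function.update (levels n s) v j) j) :
    VisitInv G R r (i + 1) (((s.setReg 8 j).setArr 4 0 v j).setReg 3 (i + 1)) := by
  have hlev : levels n (((s.setReg 8 j).setArr 4 0 v j).setReg 3 (i + 1)) =
      Function.update (levels n s) v j := by
    ext w
    simp only [levels, State.setReg_arr, State.setArr_arr_self, Function.update_apply, true_and,
      Fin.val_inj]
  refine ⟨State.setReg_reg_self .., ?_, ?_, ?_, ?_, ?_, ?_, ?_⟩
  · rw [State.setReg_reg_of_ne _ _ (by decide), State.setArr_reg,
      State.setReg_reg_of_ne _ _ (by decide), h.size]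
  · rw [State.setReg_arr, State.setArr_arr_of_ne _ _ _ _ (by decide), State.setReg_arr, h.adj]
  · rw [State.setReg_arr, State.setArr_arr_of_ne _ _ _ _ (by decide), State.setReg_arr, h.term]
  · rw [State.setReg_arr, State.setArr_arr_of_ne _ _ _ _ (by decide), State.setReg_arr]
    exact h.tree
  · rw [State.setReg_arr, State.setArr_arr_of_ne _ _ _ _ (by decide), State.setReg_arr]
    exact h.bag
  · rw [hlev, State.setReg_reg_of_ne _ _ (by decide), State.setArr_reg, State.setReg_reg_self]
    exact hlay
  · rw [hlev]
    refine Or.inr ?_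
    rw [IsLayering.ncard_visited_update hv hj]
    exact Nat.succ_le_succ (h.progress.resolve_left hnf)

/-- Running time of `Prog.scan`, up to the cost `a` of the search condition. -/
def scanTime {S : Type*} [CommSemiring S] (a : ℕ) (x : S) : S :=
  2 + (1 + (2 + (1 + a + 7) * (x + 1)) + 7) * (x + 1)

theorem le_scanTime {a : ℕ} (n : ℕ) (ha : a ≤ 60) :
    2 + (1 + (2 + (1 + a + 7) * (n + 1)) + 7) * (n + 1) ≤ scanTime 60 n := by
  unfold scanTime
  simp only [Nat.cast_id]
  gcongr

/-- Running time of `visitProg`. -/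
def visitTime {S : Type*} [CommSemiring S] (x : S) : S :=
  scanTime 60 x + scanTime 60 x + scanTime 60 x + 50

/-- A later successful scan overwrites the result of an earlier one, so the search for the current
level takes priority over opening the next level, and this over starting a component. The failed
scans supply the maximality hypotheses of `IsLayering.next` and `IsLayering.root`. -/
theorem ensures_visit {i : ℕ} {s : State} (hG : ¬ HasDecoratedSubtree G R r)
    (h : VisitInv G R r i s) :
    Ensures visitProg s (visitTime n)
      (fun s' => s'.reg 3 = i ∧ VisitInv G R r (i + 1) (s'.setReg 3 (i + 1))) := by
  have f0 : ScanFrame s (s.setReg 6 0) :=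
    ScanFrame.setReg ⟨rfl, rfl, rfl, rfl⟩ _ (by decide) (by decide) (by decide)
  have hsucc : ∀ s', ScanFrame s s' → succExpr.eval s' = s.reg 8 + 1 := fun s' hf => by
    simp only [succExpr, Expr.eval, hf.2.2.2]
  have hreg : ∀ s', ScanFrame s s' → (Expr.reg 8).eval s' = s.reg 8 := fun s' hf => hf.2.2.2
  have hroot : ∀ s', ScanFrame s s' → (rootExpr.eval s' ≠ 0 ↔
      (fun _ v => s.arr 1 0 v - s.arr 4 0 v ≠ 0) (s'.reg 4) (s'.reg 5)) := fun s' hf => by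
    simp only [rootExpr, termExpr, levExpr, Expr.eval, hf.1]
  have hnext : ∀ s', ScanFrame s s' → (nextExpr.eval s' ≠ 0 ↔
      (fun u v => s.arr 0 u v - s.arr 4 0 v - (1 - s.arr 4 0 u) ≠ 0) (s'.reg 4) (s'.reg 5)) :=
    fun s' hf => by simp only [nextExpr, levExpr, Expr.eval, hf.1]
  have hsame : ∀ s', ScanFrame s s' → (sameExpr.eval s' ≠ 0 ↔
      (fun u v => s.arr 0 u v - s.arr 4 0 v - (1 - s.arr 4 0 u) -
        (s.arr 1 0 v - (s.reg 8 - s.arr 4 0 u)) ≠ 0) (s'.reg 4) (s'.reg 5)) :=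
    fun s' hf => by
      simp only [sameExpr, nextExpr, termExpr, levExpr, Expr.eval, hf.1, hf.2.2.2]
  -- Since the input entries are at most `1`, truncated subtraction works as "and not": this is how
  -- `omega` decodes the search conditions below.
  have hadj : ∀ u v : Fin n, s.arr 0 u v ≤ 1 ∧ (s.arr 0 u v ≠ 0 ↔ G.Adj u v) := by
    rw [h.adj]; exact inputState_adj G R r
  have hterm : ∀ v : Fin n, s.arr 1 0 v ≤ 1 ∧ (s.arr 1 0 v ≠ 0 ↔ v ∈ R) := by
    rw [h.term]; exact inputState_term G R r
  have hvisit : ∀ (s' : State) (v : Fin n) (j : ℕ), ScanFrame s s' → s'.reg 6 = v + 1 →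
      s'.reg 7 = j → levels n s v = 0 → j ≠ 0 → ¬ IsFinished G R (levels n s) →
      IsLayering G R r (Function.update (levels n s) v j) j →
      Ensures (Prog.branch (Expr.reg 6) (Prog.seq (Prog.assign 8 (Expr.reg 7))
        (Prog.store 4 (Expr.const 0) (Expr.sub (Expr.reg 6) (Expr.const 1)) (Expr.reg 8)))
        Prog.skip) s' 20
        (fun s' => s'.reg 3 = i ∧ VisitInv G R r (i + 1) (s'.setReg 3 (i + 1))) := by
    intro s' v j hf h6 h7 hv hj hnf hlay
    have hlev : levels n s' = levels n s := by unfold levels; rw [hf.1]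
    refine (Ensures.branch (k' := 1) (fun _ => Ensures.assign_seq (Ensures.store ?_))
      (fun he => ?_)).mono (by decide) fun _ hs => hs
    · have e7 : (Expr.reg 7).eval s' = j := h7
      have e6 : (Expr.sub (Expr.reg 6) (Expr.const 1)).eval (s'.setReg 8 j) = v := by
        simp only [Expr.eval, State.setReg_reg_of_ne _ _ (show 6 ≠ 8 by decide), h6]
        omega
      have e8 : (Expr.reg 8).eval (s'.setReg 8 j) = j := State.setReg_reg_self ..
      rw [e7, e6, e8]
      refine ⟨?_, (h.of_frame hf).visit (hlev ▸ hv) hj (hlev ▸ hnf) (hlev ▸ hlay)⟩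
      rw [State.setArr_reg, State.setReg_reg_of_ne _ _ (by decide), hf.2.2.1, h.counter]
    · exact absurd (h6.symm.trans he) (Nat.succ_ne_zero _)
  refine (Ensures.assign_seq (e := Expr.const 0) (Ensures.seq
    (ensures_scan (P := fun _ v => s.arr 1 0 v - s.arr 4 0 v ≠ 0) (s := s.setReg 6 0) (f0.2.1.trans h.size) (fun s' hf => hroot s' (f0.trans hf))
      (fun s' hf => hsucc s' (f0.trans hf))) fun s1 h1 => Ensures.seq
    (ensures_scan (P := fun u v => s.arr 0 u v - s.arr 4 0 v - (1 - s.arr 4 0 u) ≠ 0) ((f0.trans h1.1).2.1.trans h.size)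
      (fun s' hf => hnext s' ((f0.trans h1.1).trans hf))
      (fun s' hf => hsucc s' ((f0.trans h1.1).trans hf))) fun s2 h2 => Ensures.seq
    (ensures_scan (P := fun u v => s.arr 0 u v - s.arr 4 0 v - (1 - s.arr 4 0 u) -
        (s.arr 1 0 v - (s.reg 8 - s.arr 4 0 u)) ≠ 0) (((f0.trans h1.1).trans h2.1).2.1.trans h.size)
      (fun s' hf => hsame s' (((f0.trans h1.1).trans h2.1).trans hf))
      (fun s' hf => hreg s' (((f0.trans h1.1).trans h2.1).trans hf)))
    fun s3 h3 => (?_ : Ensures _ _ 20 _))).mono ?_ fun _ hs => hs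
  · obtain ⟨f1, r1⟩ := h1
    obtain ⟨f2, r2⟩ := h2
    obtain ⟨f3, r3⟩ := h3
    have hf := ((f0.trans f1).trans f2).trans f3
    rcases r3 with ⟨n3, e36, e37⟩ | ⟨u, hu, v, hv, hp, h6, h7⟩
    · have hnone : ∀ a b, ¬ SameLevel G R (levels n s) (s.reg 8) a b := by
        rintro a b ⟨p1, p2, p3, p4⟩
        have q1 := hadj a b
        have q2 := hterm b
        have q3 := n3 a a.2 b b.2
        simp only [levels] at p2 p3 p4
        rw [← q1.2] at p1
        rw [← q2.2] at p4
        omega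
      rcases r2 with ⟨n2, e26, e27⟩ | ⟨u, hu, v, hv, hp, h6, h7⟩
      · have hnone' : ∀ a b, G.Adj a b → levels n s a ≠ 0 → levels n s b ≠ 0 := by
          intro a b p1 p2 p3
          have q1 := hadj a b
          have q3 := n2 a a.2 b b.2
          simp only [levels] at p2 p3
          rw [← q1.2] at p1
          omega
        rcases r1 with ⟨n1, e16, e17⟩ | ⟨u, hu, v, hv, hp, h6, h7⟩
        · have h6 : s3.reg 6 = 0 := by
            rw [e36, e26, e16]; exact State.setReg_reg_self ..
          have hfin : IsFinished G R (levels n s) := by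
            refine ⟨fun v hv hv0 => ?_, hnone'⟩
            have q2 := hterm v
            have q3 := n1 v v.2 v v.2
            simp only [levels] at hv0
            rw [← q2.2] at hv
            omega
          refine (Ensures.branch (e := Expr.reg 6) (k := 17) (fun he => (he h6).elim)
            (fun _ => Ensures.skip ?_)).mono (by decide) fun _ hs => hs
          have h3 := h.of_frame hf
          have hlev : levels n s3 = levels n s := by unfold levels; rw [hf.1]
          refine ⟨h3.counter, State.setReg_reg_self .., ?_, h3.adj, h3.term, h3.tree, h3.bag, ?_,
            Or.inl (hlev ▸ hfin)⟩
          · rw [State.setReg_reg_of_ne _ _ (by decide)]; exact h3.size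
          · rw [State.setReg_reg_of_ne _ _ (by decide)]; exact h3.layering
        · have q2 : s.arr 1 0 v ≤ 1 ∧ (s.arr 1 0 v ≠ 0 ↔ (⟨v, hv⟩ : Fin n) ∈ R) := hterm ⟨v, hv⟩
          have hv0 : levels n s ⟨v, hv⟩ = 0 := by simp only [levels]; omega
          have hvR : (⟨v, hv⟩ : Fin n) ∈ R := q2.2.1 (by omega)
          exact hvisit s3 ⟨v, hv⟩ _ hf (by rw [e36, e26, h6]) (by rw [e37, e27, h7]) hv0
            (Nat.succ_ne_zero _) (fun hfin => hfin.1 _ hvR hv0) (h.layering.root hnone' hv0 hvR)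
      · have q1 : s.arr 0 u v ≤ 1 ∧ (s.arr 0 u v ≠ 0 ↔ G.Adj ⟨u, hu⟩ ⟨v, hv⟩) :=
        hadj ⟨u, hu⟩ ⟨v, hv⟩
        have hv0 : levels n s ⟨v, hv⟩ = 0 := by simp only [levels]; omega
        have hu0 : levels n s ⟨u, hu⟩ ≠ 0 := by simp only [levels]; omega
        have huv : G.Adj ⟨u, hu⟩ ⟨v, hv⟩ := q1.2.1 (by omega)
        exact hvisit s3 ⟨v, hv⟩ _ hf (by rw [e36, h6]) (by rw [e37, h7]) hv0
          (Nat.succ_ne_zero _) (fun hfin => hfin.2 _ _ huv hu0 hv0)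
          (h.layering.next hnone huv hu0 hv0)
    · have q1 : s.arr 0 u v ≤ 1 ∧ (s.arr 0 u v ≠ 0 ↔ G.Adj ⟨u, hu⟩ ⟨v, hv⟩) :=
        hadj ⟨u, hu⟩ ⟨v, hv⟩
      have q2 : s.arr 1 0 v ≤ 1 ∧ (s.arr 1 0 v ≠ 0 ↔ (⟨v, hv⟩ : Fin n) ∈ R) := hterm ⟨v, hv⟩
      have hv0 : levels n s ⟨v, hv⟩ = 0 := by simp only [levels]; omega
      have hu0 : levels n s ⟨u, hu⟩ ≠ 0 := by simp only [levels]; omega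
      have huv : G.Adj ⟨u, hu⟩ ⟨v, hv⟩ := q1.2.1 (by omega)
      have hor : (⟨v, hv⟩ : Fin n) ∉ R ∨ levels n s ⟨u, hu⟩ < s.reg 8 := by
        rw [← q2.2]
        simp only [levels]
        omega
      have hle := h.layering.le ⟨u, hu⟩
      exact hvisit s3 ⟨v, hv⟩ _ hf h6 h7 hv0 (by omega)
        (fun hfin => hfin.2 _ _ huv hu0 hv0) (h.layering.same hG ⟨huv, hu0, hv0, hor⟩)
  · refine (Nat.add_le_add_left (Nat.add_le_add (le_scanTime _ (by decide))
      (Nat.add_le_add (le_scanTime _ (by decide))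
        (Nat.add_le_add_right (le_scanTime _ (by decide)) 20))) _).trans ?_
    clear * -
    unfold visitTime
    generalize scanTime 60 n = a
    simp only [Expr.cost]
    omega

end Input

/-! ## Writing the output -/

/-- The last round also writes an edge to `2 * n + 2`, which is outside the range of indices read as
output. -/
theorem ensures_edge {s : State} {n : ℕ} (hn : s.reg 0 = n) (h2 : ∀ t t', s.arr 2 t t' = 0) :
    Ensures (Prog.forLoop 4 (Expr.add (Expr.reg 0) (Expr.const 1)) edgeProg) s
      (2 + (3 + 100 + 7) * (n + 1 + 1))
      (fun s' => s'.reg 0 = n ∧ (∀ b, b ≠ 2 → s'.arr b = s.arr b) ∧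
        ∀ t t', s'.arr 2 t t' ≠ 0 ↔ ∃ i < n + 1, (t = 2 * i ∧ t' = 2 * i + 1) ∨
          (t = 2 * i + 1 ∧ t' = 2 * i) ∨ (t = 2 * i ∧ t' = 2 * i + 2) ∨
          (t = 2 * i + 2 ∧ t' = 2 * i)) := by
  refine (Ensures.forLoop (fun k s' => s'.reg 4 = k ∧ s'.reg 0 = n ∧
    (∀ b, b ≠ 2 → s'.arr b = s.arr b) ∧
    ∀ t t', s'.arr 2 t t' ≠ 0 ↔ ∃ i < k, (t = 2 * i ∧ t' = 2 * i + 1) ∨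
      (t = 2 * i + 1 ∧ t' = 2 * i) ∨ (t = 2 * i ∧ t' = 2 * i + 2) ∨
      (t = 2 * i + 2 ∧ t' = 2 * i)) ?_ ?_ ?_).mono le_rfl fun _ hs => hs.2
  · refine ⟨State.setReg_reg_self .., ?_, fun _ _ => rfl, fun t t' => ?_⟩
    · rw [State.setReg_reg_of_ne _ _ (by decide), hn]
    · rw [State.setReg_arr, h2]; simp
  · rintro i s' ⟨h4, h0, -⟩
    exact ⟨h4, by simp only [Expr.eval, h0]⟩
  · rintro i - s' ⟨h4, h0, hb, ht⟩
    refine (Ensures.store_seq (Ensures.store_seq (Ensures.store_seq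
      (Ensures.store ?_)))).mono (by decide) fun _ hs => hs
    simp only [Expr.eval, State.setArr_reg, h4]
    refine ⟨trivial, State.setReg_reg_self .., ?_, ?_, ?_⟩
    · rw [State.setReg_reg_of_ne _ _ (by decide)]; exact h0
    · intro b hb2
      simp only [State.setReg_arr, State.setArr_arr_of_ne _ _ _ _ hb2]
      exact hb b hb2
    · intro t t'
      simp only [State.setReg_arr, State.setArr_arr_self]
      constructor
      · intro hne
        by_cases hold : s'.arr 2 t t' = 0
        · refine ⟨i, Nat.lt_succ_self i, ?_⟩
          rw [hold] at hne
          split_ifs at hne <;> omega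
        · obtain ⟨k, hk, h⟩ := (ht t t').1 hold
          exact ⟨k, by omega, h⟩
      · rintro ⟨k, hk, h⟩
        by_cases hki : k = i
        · split_ifs <;> omega
        · have := (ht t t').2 ⟨k, by omega, h⟩
          split_ifs <;> omega

theorem ensures_bag {s : State} {n : ℕ} (hn : s.reg 0 = n) (h3 : ∀ t v, s.arr 3 t v = 0) :
    Ensures (Prog.forLoop 5 (Expr.reg 0) bagProg) s (2 + (1 + 100 + 7) * (n + 1))
      (fun s' => s'.reg 0 = n ∧ (∀ b, b ≠ 3 → s'.arr b = s.arr b) ∧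
        ∀ t v, s'.arr 3 t v ≠ 0 ↔ v < n ∧
          ((s.arr 1 0 v ≠ 0 ∧ (t = 2 * s.arr 4 0 v ∨ t = 2 * s.arr 4 0 v + 1 ∨
            t = 2 * s.arr 4 0 v - 2 ∨ t = 2 * s.arr 4 0 v - 1)) ∨
          (s.arr 1 0 v = 0 ∧ t = 2 * s.arr 4 0 v + 1))) := by
  refine (Ensures.forLoop (fun k s' => s'.reg 5 = k ∧ s'.reg 0 = n ∧
    (∀ b, b ≠ 3 → s'.arr b = s.arr b) ∧ ∀ t v, s'.arr 3 t v ≠ 0 ↔ v < k ∧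
      ((s.arr 1 0 v ≠ 0 ∧ (t = 2 * s.arr 4 0 v ∨ t = 2 * s.arr 4 0 v + 1 ∨
        t = 2 * s.arr 4 0 v - 2 ∨ t = 2 * s.arr 4 0 v - 1)) ∨
      (s.arr 1 0 v = 0 ∧ t = 2 * s.arr 4 0 v + 1))) ?_ ?_ ?_).mono le_rfl fun _ hs => hs.2
  · refine ⟨State.setReg_reg_self .., ?_, fun _ _ => rfl, fun t v => ?_⟩
    · rw [State.setReg_reg_of_ne _ _ (by decide), hn]
    · rw [State.setReg_arr, h3]; simp
  · rintro i s' ⟨h5, h0, -⟩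
    exact ⟨h5, h0⟩
  · rintro i - s' ⟨h5, h0, hb, ht⟩
    have b1 := hb 1 (by decide)
    have b4 := hb 4 (by decide)
    have hterm : termExpr.eval s' = s.arr 1 0 i := by
      simp only [termExpr, Expr.eval, h5, b1]
    refine (Ensures.branch (fun he => Ensures.store_seq (Ensures.store_seq (Ensures.store_seq
      (Ensures.store ?_)))) (fun he => Ensures.store ?_)).mono (by decide) fun _ hs => hs
    all_goals
      rw [hterm] at he
      simp only [levExpr, Expr.eval, State.setArr_reg, h5, b4,
        State.setArr_arr_of_ne _ _ _ _ (show 4 ≠ 3 by decide)]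
      refine ⟨trivial, State.setReg_reg_self .., ?_, ?_, ?_⟩
      · rw [State.setReg_reg_of_ne _ _ (by decide)]; exact h0
      · intro b hb3
        simp only [State.setReg_arr, State.setArr_arr_of_ne _ _ _ _ hb3]
        exact hb b hb3
      · intro t v
        have hold := ht t v
        simp only [State.setReg_arr, State.setArr_arr_self]
        by_cases hvi : v = i
        · subst hvi
          simp only [and_true]
          split_ifs <;> omega
        · simp only [hvi, and_false, if_false]
          omega

/-- Running time of `decompositionProg`. -/
def decompositionTime {S : Type*} [CommSemiring S] (x : S) : S :=
  2 + (1 + visitTime x + 7) * (x + 1) + (2 + (3 + 100 + 7) * (x + 1 + 1) +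
    (2 + (1 + 100 + 7) * (x + 1) + 6))

theorem ensures_decomposition {n : ℕ} {G : SimpleGraph (Fin n)} {R : Set (Fin n)} {r : ℕ}
    (hG : ¬ HasDecoratedSubtree G R r) :
    Ensures decompositionProg (inputState G R r) (decompositionTime n) (fun s =>
      IsOutput s (caterpillar (2 * n + 2)) (fun t => levelBag R (levels n s) t.1) ∧
      IsRefinedDecomposition G R (2 * r + 3) (caterpillar (2 * n + 2))
        (fun t => levelBag R (levels n s) t.1)) := by
  refine (Ensures.seq (Ensures.forLoop (n := n) (N := Expr.reg 0) (k := visitTime n) (VisitInv G R r) ?_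
    (fun i s h => ⟨h.counter, h.size⟩) (fun i _ s h => ensures_visit hG h)) fun s1 h1 =>
    Ensures.seq (ensures_edge h1.size h1.tree) fun s2 h2 =>
    Ensures.seq (ensures_bag h2.1 fun t v => by rw [h2.2.1 3 (by decide)]; exact h1.bag t v)
    fun s3 h3 => Ensures.assign ?_).mono le_rfl fun _ hs => hs
  · have hlev : levels n ((inputState G R r).setReg 3 0) = fun _ => 0 := by
      ext v; simp [levels, State.setReg_arr, inputState]
    refine ⟨State.setReg_reg_self .., rfl, rfl, rfl, fun _ _ => rfl, fun _ _ => rfl, ?_,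
      Or.inr (Nat.zero_le _)⟩
    rw [hlev]
    exact IsLayering.zero
  · obtain ⟨h20, h2b, h22⟩ := h2
    obtain ⟨h30, h3b, h33⟩ := h3
    set s := s3.setReg 2 _ with hs
    have hlev : levels n s = levels n s1 := by
      unfold levels
      rw [hs, State.setReg_arr, h3b 4 (by decide), h2b 4 (by decide)]
    have hcard : {v | levels n s1 v ≠ 0}.ncard ≤ n := by
      simpa using Set.ncard_le_card {v | levels n s1 v ≠ 0}
    have hfin : IsFinished G R (levels n s1) := by
      -- If the search never stopped early, `n` rounds have visited all `n` vertices.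
      rcases h1.progress with hf | hc
      · exact hf
      · have huniv : {v | levels n s1 v ≠ 0} = Set.univ :=
          Set.eq_of_subset_of_ncard_le (Set.subset_univ _) (by simpa [Set.ncard_univ] using hc)
            (Set.toFinite _)
        have hall : ∀ v, levels n s1 v ≠ 0 := fun v => huniv.ge (Set.mem_univ v)
        exact ⟨fun v _ => hall v, fun _ v _ _ => hall v⟩
    rw [hlev]
    -- Each level is opened by a new vertex, so there are at most `n` levels and the fixed
    -- caterpillar is long enough.
    refine ⟨⟨?_, ?_, ?_⟩, h1.layering.isRefinedDecomposition hfin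
      (h1.layering.count.trans hcard)⟩
    · rw [hs, State.setReg_reg_self]
      simp only [Expr.eval, h30]
      omega
    · intro t t'
      rw [hs, State.setReg_arr, h3b 2 (by decide), h22, caterpillar_adj]
      constructor
      · rintro (⟨h0, h⟩ | ⟨h0, h⟩)
        · exact ⟨(t.1 - 1) / 2, by omega, by omega⟩
        · exact ⟨(t'.1 - 1) / 2, by omega, by omega⟩
      · rintro ⟨i, hi, h⟩
        omega
    · intro t v
      have q := inputState_term G R r v
      rw [hs, State.setReg_arr, h33, h2b 1 (by decide), h2b 4 (by decide), h1.term]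
      have hv := v.2
      have hl : s1.arr 4 0 v = levels n s1 v := rfl
      rw [hl]
      simp only [levelBag, Set.mem_ofPred_eq]
      by_cases hvR : v ∈ R
      · have h0 := hfin.1 v hvR
        have hq := q.2.2 hvR
        simp only [hvR, hq, hv, not_true_eq_false, ne_eq, not_false_eq_true, true_and, false_and,
          or_false]
        omega
      · have hq : (inputState G R r).arr 1 0 v = 0 := by
          by_contra hne
          exact hvR (q.2.1 hne)
        simp only [hvR, hq, hv, not_false_eq_true, ne_eq, not_true_eq_false, true_and, false_and,
          false_or]

end Decorated

theorem theorem4 :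
    ∃ f : ℕ → ℕ,
      Asymptotics.IsBigO Filter.atTop (fun r : ℕ => (f r : ℝ)) (fun r : ℕ => (r : ℝ) ^ 2) ∧
      (∀ (V : Type*) [Finite V] (G : SimpleGraph V) (R : Set V) (r : ℕ),
        ¬ Decorated.HasDecoratedSubtree G R r →
          ∃ (m : ℕ) (T : SimpleGraph (Fin m)) (B : Fin m → Set V),
            Decorated.IsRefinedDecomposition G R (f r) T B) ∧
      ∃ (P : RAM.Prog) (p : Polynomial ℕ),
        ∀ (n : ℕ) (G : SimpleGraph (Fin n)) (R : Set (Fin n)) (r : ℕ),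
          ¬ Decorated.HasDecoratedSubtree G R r →
            ∃ (k : ℕ) (s : RAM.State), RAM.Runs P (Decorated.inputState G R r) k s ∧
              k ≤ p.eval n ∧
              ∃ (m : ℕ) (T : SimpleGraph (Fin m)) (B : Fin m → Set (Fin n)),
                Decorated.IsOutput s T B ∧
                Decorated.IsRefinedDecomposition G R (f r) T B := by
  refine ⟨fun r => 2 * r + 3, ?_, ?_, Decorated.decompositionProg,
    Decorated.decompositionTime Polynomial.X, ?_⟩
  · refine Asymptotics.IsBigO.of_bound 5 ?_
    filter_upwards [Filter.eventually_ge_atTop 1] with r hr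
    have hr' : (1 : ℝ) ≤ r := by exact_mod_cast hr
    rw [Real.norm_of_nonneg (by positivity), Real.norm_of_nonneg (by positivity)]
    push_cast
    nlinarith
  · intro V _ G R r hG
    obtain ⟨lev, j, h, hfin⟩ := Decorated.IsLayering.exists_isFinished hG
    exact ⟨_, _, _, h.isRefinedDecomposition hfin le_rfl⟩
  · intro n G R r hG
    obtain ⟨k, s, hr, hk, hout, hdec⟩ := Decorated.ensures_decomposition hG
    refine ⟨k, s, hr, hk.trans (le_of_eq ?_), _, _, _, hout, hdec⟩
    -- The running time is one formula over every commutative semiring: its value at `Polynomial.X`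
    -- evaluates to its value at `n`.
    simp [Decorated.decompositionTime, Decorated.visitTime, Decorated.scanTime]
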